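/- All graphs are finite, simple and non-empty. For a graph $G$ and an ordering of its vertices, orient every edge from its earlier to its later endpoint, and let $\Delta^-$ be the maximum in-degree of the resulting oriented graph. For an integer $\alpha\ge 0$, $G$ is called $\alpha$-greedy orientable if some ordering of its vertices satisfies $\Delta^-=\chi(G)-1+\alpha$, where $\chi(G)$ is the chromatic number. A graph is series-parallel if it can be turned into $K_2$ by finitely many operations of the following two kinds on multigraphs: identifying a vertex of degree two, with two distinct neighbours, with one of its neighbours (so that its two incident edges are replaced by one edge joining these neighbours), and deleting one of two parallel edges. A graph is outerplanar if it has a crossing-free drawing in the plane in which every vertex lies on the boundary of the outer face. For an integer $\ell\ge 0$, an $\ell$-tree is a graph obtained from a complete graph on $\ell+1$ vertices by repeatedly (possibly zero times) adding a new vertex adjacent to exactly $\ell$ of the existing vertices, such that these $\ell$ vertices and the new one form a clique. The following statements hold. (i) A connected graph is a tree if and only if it is bipartite and $0$-greedy orientable. More generally, a bipartite graph, connected or not, is $0$-greedy orientable if and only if it is a forest. (ii) Every series-parallel graph $G$ with $\chi(G)=3$ is $0$-greedy orientable. (iii) Every bipartite outerplanar graph that has a vertex of degree at least two is $1$-greedy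 orientable. (iv) For every $\ell\ge 0$, every $\ell$-tree with chromatic number $\ell+1$ is $0$-greedy orientable. -/

import Mathlib

namespace RobustColoring

universe u

/-- The in-degree of `v` in the orientation of `G` induced by the vertex ordering `σ`
(an edge is oriented from its earlier to its later endpoint). -/
noncomputable def inDegree {V : Type u} [Fintype V] (G : SimpleGraph V)
    (σ : V ≃ Fin (Fintype.card V)) (v : V) : ℕ :=
  {w : V | G.Adj w v ∧ σ w < σ v}.ncard

/-- The maximum in-degree of the orientation of `G` induced by the vertex ordering `σ`. -/
noncomputable def maxInDegree {V : Type u} [Fintype V] (G : SimpleGraph V)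
    (σ : V ≃ Fin (Fintype.card V)) : ℕ :=
  Finset.univ.sup (inDegree G σ)

/-- `G` is `α`-greedy orientable: some vertex ordering has maximum in-degree exactly
`χ(G) - 1 + α` (written without subtraction). -/
def GreedyOrientable {V : Type u} [Fintype V] (G : SimpleGraph V) (α : ℕ) : Prop :=
  ∃ σ : V ≃ Fin (Fintype.card V),
    ((maxInDegree G σ + 1 : ℕ) : ℕ∞) = G.chromaticNumber + (α : ℕ∞)

/-- A multigraph whose vertices are taken from `V`; an edge is recorded by its pair of endpoints,
with multiplicity. -/
structure Multigraph (V : Type u) where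
  verts : Set V
  edges : Multiset (Sym2 V)
  incl : ∀ e ∈ edges, ∀ v ∈ e, v ∈ verts

open Classical in
/-- A simple graph as a multigraph. -/
noncomputable def Multigraph.ofSimple {V : Type u} [Fintype V] (G : SimpleGraph V) :
    Multigraph V where
  verts := Set.univ
  edges := G.edgeFinset.val
  incl := fun _ _ v _ => Set.mem_univ v

/-- `M` is a single edge joining two distinct vertices, with no further vertices. -/
def Multigraph.IsK2 {V : Type u} (M : Multigraph V) : Prop :=
  ∃ a b : V, a ≠ b ∧ M.verts = {a, b} ∧ M.edges = {s(a, b)}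

/-- One reduction step `M → N`.
* `series`: a vertex `v` of degree two with neighbours `a ≠ b` is identified with one of them, so
  that `v` disappears and its two edges become a single edge `ab`; the condition `v ∉ N.verts`
  together with `N.incl` says that `v` is on no other edge of `M` and that `a` and `b` differ
  from `v`.
* `parallel`: one of two parallel edges is deleted. -/
inductive Multigraph.Step {V : Type u} : Multigraph V → Multigraph V → Prop
  | series {M N : Multigraph V} {v a b : V} {R : Multiset (Sym2 V)}
      (hab : a ≠ b) (hv : v ∉ N.verts) (hverts : M.verts = insert v N.verts)
      (hM : M.edges = s(v, a) ::ₘ s(v, b) ::ₘ R) (hN : N.edges = s(a, b) ::ₘ R) : Step M N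
  | parallel {M N : Multigraph V} {e : Sym2 V} {R : Multiset (Sym2 V)}
      (hverts : M.verts = N.verts)
      (hM : M.edges = e ::ₘ e ::ₘ R) (hN : N.edges = e ::ₘ R) : Step M N

/-- A simple graph is series-parallel if finitely many series and parallel reductions turn it
into `K₂`. -/
def IsSeriesParallel {V : Type u} [Fintype V] (G : SimpleGraph V) : Prop :=
  ∃ K : Multigraph V, K.IsK2 ∧ Relation.ReflTransGen Multigraph.Step (Multigraph.ofSimple G) K

/-- A crossing-free drawing of `G` in the plane `ℂ`: vertices are distinct points and
edges are simple arcs between their endpoints; an arc passes through no other vertex, and arcs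
of two different edges meet at most in points that are vertices. -/
structure PlaneDrawing {V : Type u} (G : SimpleGraph V) where
  pt : V → ℂ
  pt_inj : Function.Injective pt
  arc : ∀ {a b : V}, G.Adj a b → Path (pt a) (pt b)
  arc_symm : ∀ {a b : V} (h : G.Adj a b), arc h.symm = (arc h).symm
  arc_inj : ∀ {a b : V} (h : G.Adj a b), Function.Injective (arc h)
  pt_mem_arc : ∀ {a b : V} (h : G.Adj a b) (w : V), pt w ∈ Set.range (arc h) → w = a ∨ w = b
  arc_inter : ∀ {a b c d : V} (h : G.Adj a b) (h' : G.Adj c d), s(a, b) ≠ s(c, d) →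
    Set.range (arc h) ∩ Set.range (arc h') ⊆ Set.range pt

/-- The set of all points of the plane on the drawing. -/
def PlaneDrawing.support {V : Type u} {G : SimpleGraph V} (D : PlaneDrawing G) : Set ℂ :=
  Set.range D.pt ∪ {z | ∃ (a b : V) (h : G.Adj a b), z ∈ Set.range (D.arc h)}

/-- `F` is the outer face: an unbounded connected component of the complement of the drawing. -/
def PlaneDrawing.IsOuterFace {V : Type u} {G : SimpleGraph V} (D : PlaneDrawing G)
    (F : Set ℂ) : Prop :=
  ∃ z ∈ D.supportᶜ, F = connectedComponentIn D.supportᶜ z ∧ ¬ Bornology.IsBounded F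

/-- `G` is outerplanar: it has a crossing-free drawing in the plane in which every vertex is on
the boundary of the outer face. -/
def IsOuterplanar {V : Type u} (G : SimpleGraph V) : Prop :=
  ∃ (D : PlaneDrawing G) (F : Set ℂ), D.IsOuterFace F ∧ ∀ v : V, D.pt v ∈ frontier F

/-- The subgraph of `G` induced by `s` arises from a complete graph on `l + 1` vertices by
repeatedly adding a vertex whose neighbours among the present vertices are exactly `l` vertices
that form a clique together with it. -/
inductive IsKTreeOn {V : Type u} (G : SimpleGraph V) (l : ℕ) : Set V → Prop
  | base {s : Set V} (hfin : s.Finite) (hcard : s.ncard = l + 1) (hs : G.IsClique s) :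
      IsKTreeOn G l s
  | add {s t : Set V} {v : V} (hs : IsKTreeOn G l s) (hv : v ∉ s)
      (ht : {w ∈ s | G.Adj v w} = t) (hfin : t.Finite) (hcard : t.ncard = l)
      (hclique : G.IsClique (insert v t)) : IsKTreeOn G l (insert v s)

/-- `G` is an `l`-tree. -/
def IsKTree {V : Type u} (G : SimpleGraph V) (l : ℕ) : Prop :=
  IsKTreeOn G l Set.univ

end RobustColoring

/-!
An ordering with maximum in-degree at most `k` exists as soon as the graph is `k`-degenerate
(`DegenerateOn.exists_maxInDegree_le`), and greedy colouring along any ordering gives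
`χ(G) ≤ Δ⁻ + 1` (`chromaticNumber_le_maxInDegree_succ`). Hence a `(χ(G) - 1)`-degenerate graph is
`0`-greedy orientable. Forests are `1`-degenerate, `ℓ`-trees are `ℓ`-degenerate by construction, and
series-parallel graphs are `2`-degenerate because undoing a series reduction adds a vertex with two
neighbours. Conversely an ordering with `Δ⁻ ≤ 1` excludes cycles, since the last vertex of a cycle
has two earlier neighbours.

A bipartite outerplanar graph is `2`-degenerate. Otherwise some induced subgraph is triangle-free
with minimum degree at least three, and a longest path in it, chosen with its first chord as short
as possible, yields three internally disjoint paths of length at least two between the same two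
vertices (`exists_theta`). With all vertices on the boundary of the outer face, a point of that face
can be joined to one inner vertex of each path, which gives a drawing of `K₃,₃`
(`PlaneDrawing.false_of_theta`). That `K₃,₃` has no such drawing, even if curves with a common end
point may cross, is `k33_nonplanar`: for curves `p`, `q` without common points the function
`p s - q t` has a continuous logarithm on the square, and the resulting relations between changes of
angle are contradictory. No form of the Jordan curve theorem is needed.

Being `1`-greedy orientable requires `Δ⁻ = 2` exactly. Exchanging two consecutive vertices changes
`Δ⁻` by at most one, so all values between two attained ones are attained
(`exists_maxInDegree_eq`), and placing a vertex of degree at least two last gives `Δ⁻ ≥ 2`.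
-/

namespace RobustColoring

open SimpleGraph

universe u

/-! ### Degeneracy and vertex orderings -/

section Orderings

theorem ncard_pair_le {α : Type*} (a b : α) : ({a, b} : Set α).ncard ≤ 2 :=
  (Set.ncard_insert_le a {b}).trans (by rw [Set.ncard_singleton])

variable {V : Type u} {G H : SimpleGraph V} {k l : ℕ} {s t : Set V}

/-- `G[s]` is `k`-degenerate: `s` can be built up from the empty set one vertex at a time so that
each new vertex has at most `k` neighbours among the present ones. -/
inductive DegenerateOn (G : SimpleGraph V) (k : ℕ) : Set V → Prop
  | empty : DegenerateOn G k ∅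
  | insert {s : Set V} {v : V} (hs : DegenerateOn G k s) (hv : v ∉ s)
      (h : {w ∈ s | G.Adj w v}.ncard ≤ k) : DegenerateOn G k (insert v s)

theorem DegenerateOn.mono [Finite V] (h : DegenerateOn G k s)
    (hGH : ∀ a ∈ s, ∀ b ∈ s, H.Adj a b → G.Adj a b) : DegenerateOn H k s := by
  induction h with
  | empty => exact .empty
  | @insert s v hs hv h ih =>
    refine .insert (ih fun a ha b hb => hGH a (.inr ha) b (.inr hb)) hv (le_trans ?_ h)
    exact Set.ncard_le_ncard
      (fun w hw => ⟨hw.1, hGH w (.inr hw.1) v (.inl rfl) hw.2⟩) (Set.toFinite _)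

/-- Hereditary form of degeneracy: it suffices that every nonempty subset of the vertices has a
vertex with at most `k` neighbours inside that subset. -/
theorem degenerateOn_of_forall [Finite V]
    (h : ∀ t : Set V, t.Nonempty → ∃ v ∈ t, {w ∈ t | G.Adj w v}.ncard ≤ k) (s : Set V) :
    DegenerateOn G k s := by
  induction hn : s.ncard generalizing s with
  | zero =>
    rw [Set.ncard_eq_zero (Set.toFinite _)] at hn
    exact hn ▸ .empty
  | succ n ih =>
    have hne : s.Nonempty := by
      rw [← Set.ncard_pos (Set.toFinite _)]; omega
    obtain ⟨v, hv, hle⟩ := h s hne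
    have h1 : (s \ {v}).ncard = n := by
      rw [Set.ncard_sdiff_singleton_of_mem hv]; omega
    have h2 := DegenerateOn.insert (v := v) (ih _ h1) (by simp)
      (le_trans (Set.ncard_le_ncard (Set.inter_subset_inter_left _ Set.sdiff_subset)
        (Set.toFinite _)) hle)
    rwa [Set.insert_sdiff_singleton, Set.insert_eq_of_mem hv] at h2

theorem degenerateOn_of_ncard_le [Finite V] (h : s.ncard ≤ k + 1) : DegenerateOn G k s := by
  induction hn : s.ncard generalizing s with
  | zero =>
    rw [Set.ncard_eq_zero (Set.toFinite _)] at hn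
    exact hn ▸ .empty
  | succ n ih =>
    obtain ⟨v, hv⟩ : s.Nonempty := by
      rw [← Set.ncard_pos (Set.toFinite _)]; omega
    have h1 : (s \ {v}).ncard = n := by
      rw [Set.ncard_sdiff_singleton_of_mem hv]; omega
    have h2 := DegenerateOn.insert (G := G) (k := k) (v := v) (ih (by omega) h1) (by simp)
      (le_trans (Set.ncard_le_ncard (fun w hw => hw.1) (Set.toFinite _)) (by omega))
    rwa [Set.insert_sdiff_singleton, Set.insert_eq_of_mem hv] at h2

/-- A degenerate vertex set can be ranked so that every vertex has few neighbours of smaller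
rank: rank each vertex above all vertices present when it is added. -/
theorem DegenerateOn.exists_rank [Finite V] (h : DegenerateOn G k s) :
    ∃ f : V → ℕ, Set.InjOn f s ∧ ∀ v ∈ s, {w ∈ s | G.Adj w v ∧ f w < f v}.ncard ≤ k := by
  classical
  induction h with
  | empty => exact ⟨fun _ => 0, by simp, by simp⟩
  | @insert s v hs hv h ih =>
    obtain ⟨f, hinj, hf⟩ := ih
    obtain ⟨N, hN⟩ : ∃ N, ∀ w, f w < N := by
      obtain ⟨N, hN⟩ := (Set.finite_range f).bddAbove
      exact ⟨N + 1, fun w => Nat.lt_succ_of_le (hN ⟨w, rfl⟩)⟩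
    have hs' : ∀ w ∈ s, w ≠ v := fun w hw e => hv (e ▸ hw)
    refine ⟨Function.update f v N, ?_, ?_⟩
    · rw [Set.injOn_insert hv]
      refine ⟨fun a ha b hb => ?_, ?_⟩
      · simpa [hs' a ha, hs' b hb] using hinj ha hb
      · rintro ⟨w, hw, e⟩
        simp only [Function.update_self, Function.update_of_ne (hs' w hw)] at e
        exact (hN w).ne e
    · rintro x (rfl | hx)
      · refine le_trans (Set.ncard_le_ncard ?_ (Set.toFinite _)) h
        rintro w ⟨hw | hw, h1, h2⟩
        · exact absurd h1 (hw ▸ G.loopless.irrefl _)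
        · exact ⟨hw, h1⟩
      · refine le_trans (Set.ncard_le_ncard ?_ (Set.toFinite _)) (hf x hx)
        rintro w ⟨hw | hw, h1, h2⟩
        · subst hw
          rw [Function.update_self, Function.update_of_ne (hs' x hx)] at h2
          exact absurd (hN x) h2.not_gt
        · rw [Function.update_of_ne (hs' x hx), Function.update_of_ne (hs' w hw)] at h2
          exact ⟨hw, h1, h2⟩

variable [Fintype V]

theorem maxInDegree_le_iff {σ : V ≃ Fin (Fintype.card V)} :
    maxInDegree G σ ≤ k ↔ ∀ v, inDegree G σ v ≤ k := by
  simp [maxInDegree, Finset.sup_le_iff]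

theorem le_maxInDegree (G : SimpleGraph V) (σ : V ≃ Fin (Fintype.card V)) (v : V) :
    inDegree G σ v ≤ maxInDegree G σ :=
  maxInDegree_le_iff.1 le_rfl v

theorem DegenerateOn.exists_maxInDegree_le (h : DegenerateOn G k Set.univ) :
    ∃ σ : V ≃ Fin (Fintype.card V), maxInDegree G σ ≤ k := by
  obtain ⟨f, hinj, hf⟩ := h.exists_rank
  let _ : LinearOrder V := LinearOrder.lift' f (Set.injOn_univ.1 hinj)
  let σ := (Fintype.orderIsoFinOfCardEq V rfl).symm
  refine ⟨σ.toEquiv, maxInDegree_le_iff.2 fun v => le_trans (Set.ncard_le_ncard ?_ (Set.toFinite _))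
    (hf v trivial)⟩
  rintro w ⟨h1, h2⟩
  exact ⟨trivial, h1, σ.lt_iff_lt.1 h2⟩

/-- Greedy colouring along the ordering. -/
theorem colorable_maxInDegree_succ (G : SimpleGraph V) (σ : V ≃ Fin (Fintype.card V)) :
    G.Colorable (maxInDegree G σ + 1) := by
  classical
  set k := maxInDegree G σ with hk
  have key : ∀ n ≤ Fintype.card V, ∃ c : V → Fin (k + 1),
      ∀ a b, (σ a : ℕ) < n → (σ b : ℕ) < n → G.Adj a b → c a ≠ c b := by
    intro n
    induction n with
    | zero => exact fun _ => ⟨fun _ => 0, by simp⟩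
    | succ n ih =>
      intro hn
      obtain ⟨c, hc⟩ := ih (by omega)
      let v := σ.symm ⟨n, hn⟩
      have hv : ∀ a, (σ a : ℕ) = n → a = v := fun a ha => by
        rw [Equiv.eq_symm_apply]; exact Fin.ext ha
      have hσv : (σ v : ℕ) = n := by simp [v]
      obtain ⟨x, hx⟩ : ∃ x : Fin (k + 1), x ∉ c '' {w | G.Adj w v ∧ σ w < σ v} := by
        by_contra! hall
        have h1 : (c '' {w | G.Adj w v ∧ σ w < σ v}) = Set.univ := Set.eq_univ_of_forall hall
        have h2 := Set.ncard_image_le (f := c) (Set.toFinite {w | G.Adj w v ∧ σ w < σ v})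
        rw [h1, Set.ncard_univ, Nat.card_eq_fintype_card, Fintype.card_fin] at h2
        have h3 := le_maxInDegree G σ v
        unfold inDegree at h3
        omega
      have hx' : ∀ a, (σ a : ℕ) < n → G.Adj a v → c a ≠ x := fun a ha hav e =>
        hx ⟨a, ⟨hav, by rw [Fin.lt_def, hσv]; exact ha⟩, e⟩
      refine ⟨Function.update c v x, fun a b ha hb hab => ?_⟩
      rcases Nat.lt_succ_iff_lt_or_eq.1 ha with ha | ha <;>
        rcases Nat.lt_succ_iff_lt_or_eq.1 hb with hb | hb
      · rw [Function.update_of_ne (by rintro rfl; omega),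
          Function.update_of_ne (by rintro rfl; omega)]
        exact hc a b ha hb hab
      · rw [hv b hb] at hab ⊢
        rw [Function.update_of_ne (by rintro rfl; omega), Function.update_self]
        exact hx' a ha hab
      · rw [hv a ha] at hab ⊢
        rw [Function.update_self, Function.update_of_ne (by rintro rfl; omega)]
        exact (hx' b hb hab.symm).symm
      · rw [hv a ha, hv b hb] at hab
        exact absurd hab (G.loopless.irrefl _)
  obtain ⟨c, hc⟩ := key _ le_rfl
  exact ⟨Coloring.mk c fun {a b} hab => hc a b (σ a).2 (σ b).2 hab⟩

theorem chromaticNumber_le_maxInDegree_succ (G : SimpleGraph V)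
    (σ : V ≃ Fin (Fintype.card V)) :
    G.chromaticNumber ≤ ((maxInDegree G σ + 1 : ℕ) : ℕ∞) :=
  (colorable_maxInDegree_succ G σ).chromaticNumber_le

/-- Since greedy colouring bounds the chromatic number from above, only one inequality has to be
checked for `0`-greedy orientability. -/
theorem DegenerateOn.greedyOrientable_zero (h : DegenerateOn G k Set.univ)
    (hχ : ((k + 1 : ℕ) : ℕ∞) ≤ G.chromaticNumber) : GreedyOrientable G 0 := by
  obtain ⟨σ, hσ⟩ := h.exists_maxInDegree_le
  refine ⟨σ, ?_⟩
  rw [Nat.cast_zero, add_zero]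
  refine le_antisymm (le_trans ?_ hχ) (chromaticNumber_le_maxInDegree_succ G σ)
  exact_mod_cast Nat.succ_le_succ hσ

theorem IsKTreeOn.degenerateOn (h : IsKTreeOn G l s) : DegenerateOn G l s := by
  induction h with
  | base hfin hcard hs => exact degenerateOn_of_ncard_le hcard.le
  | @add s t v hs hv ht hfin hcard hclique ih =>
    refine .insert ih hv ?_
    simp_rw [G.adj_comm _ v]
    rw [ht]
    exact hcard.le

end Orderings

/-! ### Series-parallel graphs -/

section SeriesParallel

variable {V : Type u}

/-- The simple graph underlying a multigraph: loops and multiplicities are dropped. -/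
def Multigraph.simple (M : Multigraph V) : SimpleGraph V :=
  SimpleGraph.fromEdgeSet {e | e ∈ M.edges}

theorem Multigraph.simple_adj {M : Multigraph V} {a b : V} :
    M.simple.Adj a b ↔ s(a, b) ∈ M.edges ∧ a ≠ b := by
  simp [Multigraph.simple]

/-- Undoing a series reduction adds a vertex with two neighbours and otherwise only removes
edges; undoing a parallel reduction does not affect the underlying simple graph. -/
theorem Multigraph.Step.degenerateOn [Finite V] {M N : Multigraph V} (h : Multigraph.Step M N)
    (hN : DegenerateOn N.simple 2 N.verts) : DegenerateOn M.simple 2 M.verts := by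
  cases h with
  | @series v a b R hab hv hverts hM hN' =>
    rw [hverts]
    refine .insert (hN.mono fun x hx y hy hxy => ?_) hv ?_
    · rw [simple_adj, hM] at hxy
      rw [simple_adj, hN']
      refine ⟨?_, hxy.2⟩
      have hx' : v ≠ x := fun e => hv (e ▸ hx)
      have hy' : v ≠ y := fun e => hv (e ▸ hy)
      have h1 := hxy.1
      simp only [Multiset.mem_cons, Sym2.eq_iff] at h1 ⊢
      tauto
    · refine le_trans (Set.ncard_le_ncard (t := {a, b}) ?_ (Set.toFinite _)) (ncard_pair_le a b)
      rintro w ⟨hw, h1⟩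
      rw [simple_adj, hM] at h1
      have hw' : w ≠ v := fun e => hv (e ▸ hw)
      have h2 := h1.1
      simp only [Multiset.mem_cons, Sym2.eq_iff] at h2
      rcases h2 with (h2 | h2) | (h2 | h2) | h2
      · exact absurd h2.1 hw'
      · exact .inl h2.1
      · exact absurd h2.1 hw'
      · exact .inr h2.1
      · exact absurd (N.incl _ (hN' ▸ Multiset.mem_cons_of_mem h2) v (by simp)) hv
  | @parallel e R hverts hM hN' =>
    rw [hverts]
    refine hN.mono fun x _ y _ hxy => ?_
    rw [simple_adj, hM] at hxy
    rw [simple_adj, hN']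
    simpa using hxy

theorem IsSeriesParallel.degenerateOn [Fintype V] {G : SimpleGraph V} (h : IsSeriesParallel G) :
    DegenerateOn G 2 Set.univ := by
  obtain ⟨K, ⟨a, b, hab, hK, -⟩, hsteps⟩ := h
  have hbase : DegenerateOn K.simple 2 K.verts :=
    degenerateOn_of_ncard_le (by rw [hK]; exact (ncard_pair_le a b).trans (by omega))
  have hG : DegenerateOn (Multigraph.ofSimple G).simple 2 (Multigraph.ofSimple G).verts :=
    hsteps.head_induction_on (motive := fun M _ => DegenerateOn M.simple 2 M.verts)
      hbase fun hst _ ih => hst.degenerateOn ih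
  refine hG.mono fun x _ y _ hxy => ?_
  rw [Multigraph.simple_adj]
  exact ⟨by simpa [Multigraph.ofSimple] using hxy, hxy.ne⟩

end SeriesParallel

/-! ### Change of the logarithm along curves, and `K₃,₃` -/

section AngleChange

theorem exists_continuous_log {A : Type*} [TopologicalSpace A] [SimplyConnectedSpace A]
    [LocallyPathConnectedSpace A] {g : A → ℂ} (hg : Continuous g) (h0 : ∀ x, g x ≠ 0) :
    ∃ f : A → ℂ, Continuous f ∧ ∀ x, Complex.exp (f x) = g x := by
  obtain ⟨x₀⟩ : Nonempty A := inferInstance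
  obtain ⟨F, ⟨-, hF⟩, -⟩ := Complex.isCoveringMapOn_exp.existsUnique_continuousMap_lifts
    (⟨g, hg⟩ : C(A, ℂ)) (Complex.exp_log (h0 x₀)) h0
  exact ⟨F, F.continuous, fun x => congrFun hF x⟩

/-- Logarithms of two functions that differ by a constant factor differ by a constant. -/
theorem sub_eq_sub_of_exp_eq {f f' : ℝ → ℂ} (hf : Continuous f) (hf' : Continuous f') {c : ℂ}
    (h : ∀ x, Complex.exp (f x) = c * Complex.exp (f' x)) (x y : ℝ) :
    f x - f y = f' x - f' y := by
  have hF := Complex.isCoveringMapOn_exp.existsUnique_continuousMap_lifts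
    (⟨fun s => Complex.exp (f s), by fun_prop⟩ : C(ℝ, ℂ)) (a₀ := y) (e₀ := f y) rfl
    (fun s => Complex.exp_ne_zero _)
  have h1 : Complex.exp (f y - f' y) = c := by
    rw [Complex.exp_sub, h, mul_div_cancel_right₀ _ (Complex.exp_ne_zero _)]
  have h2 := hF.unique (y₁ := ⟨f, hf⟩) (y₂ := ⟨fun s => (f y - f' y) + f' s, by fun_prop⟩)
    ⟨rfl, rfl⟩ ⟨by simp, by
      ext s
      simp [Complex.exp_add, h1, h s]⟩
  have h3 : f x = (f y - f' y) + f' x := DFunLike.congr_fun h2 x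
  rw [h3]; ring

open Classical in
/-- The total change of a continuous logarithm of `p` over `[0, 1]`; it is `0` if `p` has no
continuous logarithm. -/
noncomputable def logChange (p : ℝ → ℂ) : ℂ :=
  if h : ∃ f : ℝ → ℂ, Continuous f ∧ ∀ s, Complex.exp (f s) = p s then
    h.choose 1 - h.choose 0 else 0

theorem logChange_eq {p f : ℝ → ℂ} (hf : Continuous f) {c : ℂ} (hc : c ≠ 0)
    (h : ∀ s, Complex.exp (f s) = c * p s) : logChange p = f 1 - f 0 := by
  have hex : ∃ f : ℝ → ℂ, Continuous f ∧ ∀ s, Complex.exp (f s) = p s := by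
    refine ⟨fun s => f s - Complex.log c, by fun_prop, fun s => ?_⟩
    rw [Complex.exp_sub, h, Complex.exp_log hc, mul_div_cancel_left₀ _ hc]
  rw [logChange, dif_pos hex]
  exact (sub_eq_sub_of_exp_eq hf hex.choose_spec.1
    (fun s => by rw [h, hex.choose_spec.2]) 1 0).symm

theorem exp_logChange {p : ℝ → ℂ} (hp : Continuous p) (h0 : ∀ s, p s ≠ 0) :
    Complex.exp (logChange p) = p 1 / p 0 := by
  obtain ⟨f, hf, hfp⟩ := exists_continuous_log hp h0
  rw [logChange_eq hf one_ne_zero (by simpa using hfp), Complex.exp_sub, hfp, hfp]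

/-- A logarithm of `p s - q t` on the unit square has total change `0` around its boundary. -/
theorem logChange_sub_eq {p q : ℝ → ℂ} (hp : Continuous p) (hq : Continuous q)
    (h : ∀ s t, p s ≠ q t) :
    logChange (fun s => p s - q 1) - logChange (fun s => p s - q 0) =
      logChange (fun t => q t - p 1) - logChange (fun t => q t - p 0) := by
  obtain ⟨L, hL, hLe⟩ := exists_continuous_log (A := ℝ × ℝ) (g := fun x => p x.1 - q x.2)
    (by fun_prop) (fun x => sub_ne_zero.2 (h _ _))
  have h1 : ∀ t, logChange (fun s => p s - q t) = L (1, t) - L (0, t) := fun t =>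
    logChange_eq (f := fun s => L (s, t)) (by fun_prop) one_ne_zero (by simp [hLe])
  have h2 : ∀ s, logChange (fun t => q t - p s) = L (s, 1) - L (s, 0) := fun s =>
    logChange_eq (f := fun t => L (s, t)) (by fun_prop) (neg_ne_zero.2 one_ne_zero)
      (by simp [hLe])
  rw [h1, h1, h2, h2]; ring

/-- `K₃,₃` is not planar, in the strong form of van Kampen and Hanani–Tutte: for curves joining
each of three points `a i` to each of three points `b j` in the plane, some two curves without
common end point meet.

Otherwise every pair of independent edges yields a relation `logChange_sub_eq`. In the signed sum
of the 18 relations each term cancels or appears twice, which leaves twice a combination of the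
angles under which the three edges at `a 1` are seen from the points `b l`. The exponential of
this combination is a product in which the factors with `a 1` cancel and each of the three pairs
`j < l` contributes `(b j - b l) / (b l - b j)` or its inverse, so it is `(-1) ^ 3 = -1`. -/
theorem k33_nonplanar (a b : Fin 3 → ℂ) (p : Fin 3 → Fin 3 → ℝ → ℂ)
    (hp : ∀ i j, Continuous (p i j)) (h0 : ∀ i j, p i j 0 = a i) (h1 : ∀ i j, p i j 1 = b j)
    (hne : ∀ i j k l, i ≠ k → j ≠ l → ∀ s t, p i j s ≠ p k l t) : False := by
  have hsq : ∀ i j k l, i ≠ k → j ≠ l →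
      logChange (fun s => p i j s - b l) - logChange (fun s => p i j s - a k) =
        logChange (fun s => p k l s - b j) - logChange (fun s => p k l s - a i) := by
    intro i j k l hik hjl
    have := logChange_sub_eq (hp i j) (hp k l) (hne i j k l hik hjl)
    simpa only [h0, h1] using this
  have hab : ∀ i l, a i ≠ b l := by
    intro i l
    obtain ⟨k, hk⟩ : ∃ k : Fin 3, k ≠ i := exists_ne i
    obtain ⟨j, hj⟩ : ∃ j : Fin 3, j ≠ l := exists_ne l
    have := hne i j k l hk.symm hj 0 1
    rwa [h0, h1] at this
  have hbb : ∀ j l, j ≠ l → b j ≠ b l := by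
    intro j l hjl
    have := hne 0 j 1 l (by decide) hjl 1 1
    rwa [h1, h1] at this
  have hexp : ∀ j l, j ≠ l →
      Complex.exp (logChange (fun s => p 1 j s - b l)) = (b j - b l) / (a 1 - b l) := by
    intro j l hjl
    have hc := hp 1 j
    rw [exp_logChange (by fun_prop), h0, h1]
    intro s
    have := hne 1 j 0 l (by decide) hjl s 1
    rw [h1] at this
    exact sub_ne_zero.2 this
  have hsum : logChange (fun s => p 1 2 s - b 0) - logChange (fun s => p 1 1 s - b 0)
      + (logChange (fun s => p 1 0 s - b 1) - logChange (fun s => p 1 2 s - b 1))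
      + (logChange (fun s => p 1 1 s - b 2) - logChange (fun s => p 1 0 s - b 2)) = 0 := by
    -- The relation for `i, j, k, l` gets the sign `+` if both or neither of `k - i`, `l - j`
    -- are `1` modulo `3`; this choice leaves only the terms with `i = 1` written above.
    linear_combination (1 / 2 : ℂ) * (
      hsq 0 0 1 1 (by decide) (by decide) - hsq 0 0 1 2 (by decide) (by decide)
      - hsq 0 0 2 1 (by decide) (by decide) + hsq 0 0 2 2 (by decide) (by decide)
      - hsq 0 1 1 0 (by decide) (by decide) + hsq 0 1 1 2 (by decide) (by decide)
      + hsq 0 1 2 0 (by decide) (by decide) - hsq 0 1 2 2 (by decide) (by decide)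
      + hsq 0 2 1 0 (by decide) (by decide) - hsq 0 2 1 1 (by decide) (by decide)
      - hsq 0 2 2 0 (by decide) (by decide) + hsq 0 2 2 1 (by decide) (by decide)
      + hsq 1 0 2 1 (by decide) (by decide) - hsq 1 0 2 2 (by decide) (by decide)
      - hsq 1 1 2 0 (by decide) (by decide) + hsq 1 1 2 2 (by decide) (by decide)
      + hsq 1 2 2 0 (by decide) (by decide) - hsq 1 2 2 1 (by decide) (by decide))
  have := congrArg Complex.exp hsum
  rw [Complex.exp_add, Complex.exp_add, Complex.exp_sub, Complex.exp_sub, Complex.exp_sub,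
    hexp _ _ (by decide), hexp _ _ (by decide), hexp _ _ (by decide), hexp _ _ (by decide),
    hexp _ _ (by decide), hexp _ _ (by decide), Complex.exp_zero] at this
  have e0 := sub_ne_zero.2 (hab 1 0)
  have e1 := sub_ne_zero.2 (hab 1 1)
  have e2 := sub_ne_zero.2 (hab 1 2)
  have e01 := sub_ne_zero.2 (hbb 0 1 (by decide))
  have e02 := sub_ne_zero.2 (hbb 0 2 (by decide))
  have e12 := sub_ne_zero.2 (hbb 1 2 (by decide))
  rw [← neg_sub (b 0) (b 1), ← neg_sub (b 0) (b 2), ← neg_sub (b 1) (b 2)] at this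
  field_simp at this
  norm_num at this

/-- Set form of `k33_nonplanar`. -/
theorem k33_nonplanar_joinedIn (a b : Fin 3 → ℂ) (E : Fin 3 → Fin 3 → Set ℂ)
    (hE : ∀ i j, JoinedIn (E i j) (a i) (b j))
    (hdisj : ∀ i j k l, i < k → j ≠ l → Disjoint (E i j) (E k l)) : False := by
  choose γ hγ using hE
  refine k33_nonplanar a b (fun i j => (γ i j).extend) (fun i j => (γ i j).continuous_extend)
    (fun i j => (γ i j).extend_zero) (fun i j => (γ i j).extend_one) ?_
  have hmem : ∀ i j s, (γ i j).extend s ∈ E i j :=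
    fun i j s => hγ i j (Set.projIcc 0 1 zero_le_one s)
  intro i j k l hik hjl s t e
  rcases lt_or_gt_of_ne hik with h | h
  · exact Set.disjoint_left.1 (hdisj i j k l h hjl) (hmem i j s) (e ▸ hmem k l t)
  · exact Set.disjoint_left.1 (hdisj k l i j h hjl.symm) (hmem k l t) (e ▸ hmem i j s)

end AngleChange

/-! ### Theta graphs in plane drawings -/

section Drawings

variable {V : Type u} {G : SimpleGraph V}

/-- The part of the drawing formed by the vertices in `T` and the edges inside `T`. -/
def PlaneDrawing.part (D : PlaneDrawing G) (T : Set V) : Set ℂ :=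
  D.pt '' T ∪ {z | ∃ (a b : V) (h : G.Adj a b), a ∈ T ∧ b ∈ T ∧ z ∈ Set.range (D.arc h)}

theorem PlaneDrawing.support_eq_part_univ (D : PlaneDrawing G) :
    D.support = D.part Set.univ := by
  simp [support, part]

theorem PlaneDrawing.part_mono (D : PlaneDrawing G) {T U : Set V} (h : T ⊆ U) :
    D.part T ⊆ D.part U := by
  rintro z (⟨v, hv, rfl⟩ | ⟨a, b, hab, ha, hb, hz⟩)
  · exact .inl ⟨v, h hv, rfl⟩
  · exact .inr ⟨a, b, hab, h ha, h hb, hz⟩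

theorem PlaneDrawing.isClosed_part [Finite V] (D : PlaneDrawing G) (T : Set V) :
    IsClosed (D.part T) := by
  have h : {z | ∃ (a b : V) (h : G.Adj a b), a ∈ T ∧ b ∈ T ∧ z ∈ Set.range (D.arc h)} =
      ⋃ x : {x : V × V // G.Adj x.1 x.2 ∧ x.1 ∈ T ∧ x.2 ∈ T}, Set.range (D.arc x.2.1) := by
    ext z
    simp only [Set.mem_ofPred_eq, Set.mem_iUnion]
    exact ⟨fun ⟨a, b, h, ha, hb, hz⟩ => ⟨⟨(a, b), h, ha, hb⟩, hz⟩,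
      fun ⟨⟨(a, b), h, ha, hb⟩, hz⟩ => ⟨a, b, h, ha, hb, hz⟩⟩
  unfold part
  rw [h]
  exact ((Set.toFinite T).image _).isClosed.union
    (isClosed_iUnion_of_finite fun x => (isCompact_range (D.arc x.2.1).continuous).isClosed)

theorem PlaneDrawing.disjoint_part (D : PlaneDrawing G) {T U : Set V} (h : Disjoint T U) :
    Disjoint (D.part T) (D.part U) := by
  rw [Set.disjoint_left] at h ⊢
  rintro z (⟨v, hv, rfl⟩ | ⟨a, b, hab, ha, hb, hz⟩) (⟨w, hw, e⟩ | ⟨c, d, hcd, hc, hd, hz'⟩)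
  · exact h hv (D.pt_inj e ▸ hw)
  · rcases D.pt_mem_arc hcd v hz' with rfl | rfl
    · exact h hv hc
    · exact h hv hd
  · subst e
    rcases D.pt_mem_arc hab w hz with rfl | rfl
    · exact h ha hw
    · exact h hb hw
  · obtain ⟨v, rfl⟩ := D.arc_inter hab hcd (fun e => by
      rcases Sym2.eq_iff.1 e with ⟨rfl, -⟩ | ⟨rfl, -⟩
      · exact h ha hc
      · exact h ha hd) ⟨hz, hz'⟩
    have hvT : v ∈ T := by rcases D.pt_mem_arc hab v hz with rfl | rfl <;> assumption
    have hvU : v ∈ U := by rcases D.pt_mem_arc hcd v hz' with rfl | rfl <;> assumption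
    exact h hvT hvU

theorem PlaneDrawing.joinedIn_of_adj (D : PlaneDrawing G) {T : Set V} {a b : V} (h : G.Adj a b)
    (ha : a ∈ T) (hb : b ∈ T) : JoinedIn (D.part T) (D.pt a) (D.pt b) :=
  ⟨D.arc h, fun t => .inr ⟨a, b, h, ha, hb, t, rfl⟩⟩

theorem PlaneDrawing.joinedIn_of_chain (D : PlaneDrawing G) {T : Set V} {f : ℕ → V} {m n : ℕ}
    (hmn : m ≤ n) (hadj : ∀ r, m ≤ r → r < n → G.Adj (f r) (f (r + 1)))
    (hT : ∀ r, m ≤ r → r ≤ n → f r ∈ T) :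
    JoinedIn (D.part T) (D.pt (f m)) (D.pt (f n)) := by
  induction n, hmn using Nat.le_induction with
  | base => exact JoinedIn.refl (.inl ⟨_, hT m le_rfl le_rfl, rfl⟩)
  | succ n hmn ih =>
    exact (ih (fun r h1 h2 => hadj r h1 (by omega)) fun r h1 h2 => hT r h1 (by omega)).trans
      (D.joinedIn_of_adj (hadj n hmn (by omega)) (hT n hmn (by omega))
        (hT (n + 1) (by omega) le_rfl))

/-- A drawing with all vertices in the closure of one face contains no subdivision of `K₂,₃`:
`T j` and `U j` carry connections from `x` and `y` to the vertex `b j`, and a point of the face,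
joined to all three `b j`, would complete a drawing of `K₃,₃`. -/
theorem PlaneDrawing.false_of_theta [Finite V] (D : PlaneDrawing G) {F : Set ℂ}
    (hF : IsPathConnected F) (hFD : Disjoint F D.support) (hcl : ∀ v, D.pt v ∈ closure F)
    (x y : V) (b : Fin 3 → V) (T U : Fin 3 → Set V)
    (hbT : ∀ j, b j ∈ T j) (hbU : ∀ j, b j ∈ U j)
    (hT : ∀ j, JoinedIn (D.part (T j)) (D.pt x) (D.pt (b j)))
    (hU : ∀ j, JoinedIn (D.part (U j)) (D.pt y) (D.pt (b j)))
    (hTU : ∀ j l, j ≠ l → Disjoint (T j) (U l)) : False := by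
  obtain ⟨w, hw⟩ := hF.nonempty
  have hball : ∀ j, ∃ ε > 0, ∀ l, l ≠ j →
      Disjoint (Metric.ball (D.pt (b j)) ε) (D.part (T l)) ∧
      Disjoint (Metric.ball (D.pt (b j)) ε) (D.part (U l)) := by
    intro j
    let K : Set ℂ := ⋃ l : {l // l ≠ j}, (D.part (T l) ∪ D.part (U l))
    have hK : IsClosed K := isClosed_iUnion_of_finite fun l =>
      (D.isClosed_part _).union (D.isClosed_part _)
    have hsub : ∀ S, b j ∉ S → D.pt (b j) ∉ D.part S := fun S hS =>
      Set.disjoint_left.1 (D.disjoint_part (Set.disjoint_singleton_left.2 hS))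
        (.inl ⟨_, rfl, rfl⟩)
    have hbK : D.pt (b j) ∈ Kᶜ := by
      simp only [K, Set.mem_compl_iff, Set.mem_iUnion, not_exists, Set.mem_union, not_or]
      rintro ⟨l, hl⟩
      exact ⟨hsub _ fun h => Set.disjoint_left.1 (hTU l j hl) h (hbU j),
        hsub _ fun h => Set.disjoint_left.1 (hTU j l hl.symm) (hbT j) h⟩
    obtain ⟨ε, hε, h⟩ := Metric.isOpen_iff.1 hK.isOpen_compl _ hbK
    refine ⟨ε, hε, fun l hl => ?_⟩
    have := (Set.subset_compl_iff_disjoint_right.1 h).mono_right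
      (Set.subset_iUnion (fun l : {l // l ≠ j} => D.part (T l) ∪ D.part (U l)) ⟨l, hl⟩)
    exact Set.disjoint_union_right.1 this
  choose ε hε hdisj using hball
  have hFp : ∀ S, Disjoint F (D.part S) := fun S => by
    rw [D.support_eq_part_univ] at hFD
    exact hFD.mono_right (D.part_mono (Set.subset_univ S))
  refine k33_nonplanar_joinedIn ![D.pt x, D.pt y, w] (fun j => D.pt (b j))
    ![fun j => D.part (T j), fun j => D.part (U j),
      fun j => F ∪ Metric.ball (D.pt (b j)) (ε j)] ?_ ?_
  · intro i j
    fin_cases i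
    · exact hT j
    · exact hU j
    · obtain ⟨z, hzB, hzF⟩ := mem_closure_iff.1 (hcl (b j)) _ Metric.isOpen_ball
        (Metric.mem_ball_self (hε j))
      have h1 : JoinedIn F w z := hF.joinedIn w hw z hzF
      have h2 : JoinedIn (Metric.ball (D.pt (b j)) (ε j)) z (D.pt (b j)) :=
        ((convex_ball _ _).isPathConnected ⟨z, hzB⟩).joinedIn z hzB _
          (Metric.mem_ball_self (hε j))
      exact (h1.mono Set.subset_union_left).trans (h2.mono Set.subset_union_right)
  · intro i j k l hik hjl
    fin_cases i <;> fin_cases k <;> first | exact absurd hik (by decide) | skip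
    · exact D.disjoint_part (hTU j l hjl)
    · exact (Set.disjoint_union_left.2 ⟨hFp _, (hdisj l j hjl).1⟩).symm
    · exact (Set.disjoint_union_left.2 ⟨hFp _, (hdisj l j hjl).2⟩).symm

end Drawings

/-! ### Longest paths and theta subgraphs -/

section LongestPaths

variable {V : Type u} {G : SimpleGraph V} {S : Set V} {f : ℕ → V} {n : ℕ}

/-- `f 0, …, f n` is a path of `G` inside `S`; the values of `f` beyond `n` are irrelevant. -/
structure IsPathIn (G : SimpleGraph V) (S : Set V) (f : ℕ → V) (n : ℕ) : Prop where
  injOn : Set.InjOn f (Set.Iic n)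
  adj : ∀ m < n, G.Adj (f m) (f (m + 1))
  mem : ∀ m ≤ n, f m ∈ S

theorem exists_longest_pathIn [Finite V] (G : SimpleGraph V) (hS : S.Nonempty) :
    ∃ n, (∃ f, IsPathIn G S f n) ∧ ∀ m g, IsPathIn G S g m → m ≤ n := by
  classical
  obtain ⟨v, hv⟩ := hS
  have hbound : ∀ m g, IsPathIn G S g m → m ≤ Nat.card V := by
    intro m g hg
    have h1 := hg.injOn.ncard_image
    have h2 := Set.ncard_le_card (g '' Set.Iic m)
    have h3 : (Set.Iic m).ncard = m + 1 := by
      rw [Set.ncard_eq_toFinset_card']; simp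
    omega
  have h0 : IsPathIn G S (fun _ => v) 0 :=
    ⟨fun a ha b hb _ => by simp at ha hb; omega, by simp, fun _ _ => hv⟩
  refine ⟨Nat.findGreatest (fun m => ∃ f, IsPathIn G S f m) (Nat.card V),
    Nat.findGreatest_spec (P := fun m => ∃ f, IsPathIn G S f m) (Nat.zero_le _) ⟨_, h0⟩, ?_⟩
  exact fun m g hg => Nat.le_findGreatest (hbound m g hg) ⟨g, hg⟩

/-- All neighbours of the first vertex of a longest path lie on the path. -/
theorem IsPathIn.exists_eq_of_adj (hf : IsPathIn G S f n)
    (hmax : ∀ m g, IsPathIn G S g m → m ≤ n) {x : V} (hx : x ∈ S) (h : G.Adj x (f 0)) :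
    ∃ m, 1 ≤ m ∧ m ≤ n ∧ f m = x := by
  by_contra! hno
  have hne : ∀ m ≤ n, f m ≠ x := by
    intro m hm
    rcases Nat.eq_zero_or_pos m with rfl | h0
    · exact h.ne'
    · exact hno m h0 hm
  let g : ℕ → V := fun m => Nat.casesOn m x f
  have hg : IsPathIn G S g (n + 1) := by
    refine ⟨?_, ?_, ?_⟩
    · rintro (_ | a) ha (_ | b) hb e
      · rfl
      · exact absurd e.symm (hne b (Nat.le_of_succ_le_succ hb))
      · exact absurd e (hne a (Nat.le_of_succ_le_succ ha))
      · rw [hf.injOn (Nat.le_of_succ_le_succ ha) (Nat.le_of_succ_le_succ hb) e]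
    · rintro (_ | m) hm
      · exact h
      · exact hf.adj m (by omega)
    · rintro (_ | m) hm
      · exact hx
      · exact hf.mem m (by omega)
  exact absurd (hmax _ _ hg) (by omega)

/-- Rotating a path along an edge from its first vertex to `f i` reverses the part before
`f i`. -/
theorem IsPathIn.rotate (hf : IsPathIn G S f n) {i : ℕ} (hi : 1 ≤ i) (hin : i ≤ n)
    (h : G.Adj (f 0) (f i)) :
    IsPathIn G S (fun m => if m < i then f (i - 1 - m) else f m) n := by
  refine ⟨?_, ?_, ?_⟩
  · intro a ha b hb e
    have ha' : a ≤ n := ha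
    have hb' : b ≤ n := hb
    simp only at e
    split_ifs at e with h1 h2 h2
    · have := hf.injOn (show i - 1 - a ≤ n by omega) (show i - 1 - b ≤ n by omega) e; omega
    · have := hf.injOn (show i - 1 - a ≤ n by omega) hb e; omega
    · have := hf.injOn ha (show i - 1 - b ≤ n by omega) e; omega
    · exact hf.injOn ha hb e
  · intro m hm
    split_ifs with h1 h2 h2
    · have := (hf.adj (i - 1 - (m + 1)) (by omega)).symm
      rwa [show i - 1 - (m + 1) + 1 = i - 1 - m by omega] at this
    · obtain rfl : i = m + 1 := by omega
      simpa using h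
    · omega
    · exact hf.adj m hm
  · intro m hm
    split_ifs
    · exact hf.mem _ (by omega)
    · exact hf.mem m hm

/-- A triangle-free graph of minimum degree at least three contains a subdivision of `K₂,₃`, given
here as a path with three chords. Among all longest paths with a chord from the first vertex to
`f i` choose one with `i` minimal. By minimality, the first vertex of the path rotated along this
chord, which is `f (i - 1)`, has its third neighbour `f k` beyond `f i`. -/
theorem exists_theta [Finite V] (hS : S.Nonempty)
    (htri : ∀ a b c, G.Adj a b → G.Adj b c → ¬ G.Adj a c)
    (hdeg : ∀ v ∈ S, 3 ≤ {w ∈ S | G.Adj w v}.ncard) :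
    ∃ f n i j k, IsPathIn G S f n ∧ 3 ≤ i ∧ i < j ∧ i < k ∧ j ≤ n ∧ k ≤ n ∧
      G.Adj (f 0) (f i) ∧ G.Adj (f 0) (f j) ∧ G.Adj (f (i - 1)) (f k) := by
  classical
  have hthird : ∀ v ∈ S, ∀ a b, ∃ c ∈ S, G.Adj c v ∧ c ≠ a ∧ c ≠ b := by
    intro v hv a b
    by_contra! hno
    have h1 : {w ∈ S | G.Adj w v} ⊆ {a, b} := fun w hw => by
      by_cases h : w = a
      · exact .inl h
      · exact .inr (hno w hw.1 hw.2 h)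
    have h2 := (Set.ncard_le_ncard h1 (Set.toFinite _)).trans (ncard_pair_le a b)
    have := hdeg v hv
    omega
  obtain ⟨n, ⟨f₀, hf₀⟩, hmax⟩ := exists_longest_pathIn G hS
  have hex : ∃ i, 2 ≤ i ∧ i ≤ n ∧ ∃ f, IsPathIn G S f n ∧ G.Adj (f 0) (f i) := by
    obtain ⟨c, hc, hadj, h1, -⟩ := hthird (f₀ 0) (hf₀.mem 0 (by omega)) (f₀ 1) (f₀ 1)
    obtain ⟨i, hi1, hin, rfl⟩ := hf₀.exists_eq_of_adj hmax hc hadj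
    refine ⟨i, ?_, hin, f₀, hf₀, hadj.symm⟩
    have : i ≠ 1 := by rintro rfl; exact h1 rfl
    omega
  obtain ⟨hi2, hin, f, hf, hfi⟩ := Nat.find_spec hex
  have hmin : ∀ m g, 2 ≤ m → m ≤ n → IsPathIn G S g n → G.Adj (g 0) (g m) → Nat.find hex ≤ m :=
    fun m g h2 hm hg hadj => Nat.find_min' hex ⟨h2, hm, g, hg, hadj⟩
  generalize Nat.find hex = i at *
  have hi3 : 3 ≤ i := by
    by_contra hlt
    obtain rfl : i = 2 := by omega
    exact htri _ _ _ (hf.adj 0 (by omega)) (hf.adj 1 (by omega)) hfi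
  -- A third neighbour of the first vertex of a longest path with chord to position `i`.
  have hnext : ∀ g, IsPathIn G S g n → ∃ j, i < j ∧ j ≤ n ∧ G.Adj (g 0) (g j) := by
    intro g hg
    obtain ⟨c, hc, hadj, h1, h2⟩ := hthird (g 0) (hg.mem 0 (by omega)) (g 1) (g i)
    obtain ⟨j, hj1, hjn, rfl⟩ := hg.exists_eq_of_adj hmax hc hadj
    have hj1' : j ≠ 1 := by rintro rfl; exact h1 rfl
    have hji : j ≠ i := by rintro rfl; exact h2 rfl
    have := hmin j g (by omega) hjn hg hadj.symm
    exact ⟨j, by omega, hjn, hadj.symm⟩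
  obtain ⟨j, hij, hjn, hadj⟩ := hnext f hf
  obtain ⟨k, hik, hkn, hadj'⟩ := hnext _ (hf.rotate (by omega) hin hfi)
  refine ⟨f, n, i, j, k, hf, hi3, hij, hik, hjn, hkn, hfi, hadj, ?_⟩
  simpa [show 0 < i by omega, show ¬ k < i by omega] using hadj'

end LongestPaths

/-! ### Outerplanar graphs -/

section Outerplanar

variable {V : Type u} {G : SimpleGraph V}

theorem IsOuterplanar.degenerateOn [Finite V] (h : IsOuterplanar G)
    (htri : ∀ a b c, G.Adj a b → G.Adj b c → ¬ G.Adj a c) (s : Set V) : DegenerateOn G 2 s := by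
  refine degenerateOn_of_forall (fun S hS => ?_) s
  by_contra! hdeg
  obtain ⟨f, n, i, j, k, hf, hi3, hij, hik, hjn, hkn, hfi, hfj, hfk⟩ := exists_theta hS htri hdeg
  obtain ⟨D, F, ⟨z, hz, rfl, -⟩, hfr⟩ := h
  have hopen : IsOpen D.supportᶜ := by
    rw [D.support_eq_part_univ]
    exact (D.isClosed_part _).isOpen_compl
  have hF : IsPathConnected (connectedComponentIn D.supportᶜ z) :=
    hopen.connectedComponentIn.isConnected_iff_isPathConnected.1
      (isConnected_connectedComponentIn_iff.2 hz)
  -- The three paths of the theta graph between `f 0` and `f (i - 1)` run through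
  -- `f 1, …, f (i - 2)`, through `f i`, and through the path between `f j` and `f k`.
  let A : Fin 3 → Set ℕ := ![{0, 1}, {0, i}, {0, j}]
  let B : Fin 3 → Set ℕ := ![Set.Icc 1 (i - 1), {i - 1, i}, insert (i - 1) (Set.Icc (i + 1) n)]
  have hA : ∀ l, A l ⊆ Set.Iic n := by
    intro l m hm
    fin_cases l <;> simp [A] at hm ⊢ <;> omega
  have hB : ∀ l, B l ⊆ Set.Iic n := by
    intro l m hm
    fin_cases l <;> simp [B] at hm ⊢ <;> omega
  refine D.false_of_theta hF ?_ (fun v => frontier_subset_closure (hfr v)) (f 0) (f (i - 1))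
    ![f 1, f i, f j] (fun l => f '' A l) (fun l => f '' B l) ?_ ?_ ?_ ?_ ?_
  · exact Set.subset_compl_iff_disjoint_right.1 (connectedComponentIn_subset _ _)
  · intro l
    fin_cases l
    · exact Set.mem_image_of_mem f (show 1 ∈ A 0 by simp [A])
    · exact Set.mem_image_of_mem f (show i ∈ A 1 by simp [A])
    · exact Set.mem_image_of_mem f (show j ∈ A 2 by simp [A])
  · intro l
    fin_cases l
    · exact Set.mem_image_of_mem f (show 1 ∈ B 0 from ⟨le_rfl, by omega⟩)
    · exact Set.mem_image_of_mem f (show i ∈ B 1 by simp [B])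
    · exact Set.mem_image_of_mem f (show j ∈ B 2 from .inr ⟨hij, hjn⟩)
  · intro l
    fin_cases l
    · exact D.joinedIn_of_adj (hf.adj 0 (by omega)) ⟨0, by simp [A], rfl⟩ ⟨1, by simp [A], rfl⟩
    · exact D.joinedIn_of_adj hfi ⟨0, by simp [A], rfl⟩ ⟨i, by simp [A], rfl⟩
    · exact D.joinedIn_of_adj hfj ⟨0, by simp [A], rfl⟩ ⟨j, by simp [A], rfl⟩
  · intro l
    fin_cases l
    · exact (D.joinedIn_of_chain (by omega) (fun r _ _ => hf.adj r (by omega))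
        fun r h1 h2 => Set.mem_image_of_mem f (show r ∈ B 0 from ⟨h1, h2⟩)).symm
    · have := hf.adj (i - 1) (by omega)
      rw [show i - 1 + 1 = i by omega] at this
      exact D.joinedIn_of_adj this ⟨i - 1, by simp [B], rfl⟩ ⟨i, by simp [B], rfl⟩
    · refine (D.joinedIn_of_adj hfk (Set.mem_image_of_mem f (show i - 1 ∈ B 2 from .inl rfl))
        (Set.mem_image_of_mem f (show k ∈ B 2 from .inr ⟨hik, hkn⟩))).trans ?_
      have hmem : ∀ r, i < r → r ≤ n → f r ∈ f '' B 2 := fun r h1 h2 => ⟨r, .inr ⟨h1, h2⟩, rfl⟩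
      rcases le_total k j with hkj | hkj
      · exact D.joinedIn_of_chain hkj (fun r _ _ => hf.adj r (by omega))
          fun r _ _ => hmem r (by omega) (by omega)
      · exact (D.joinedIn_of_chain hkj (fun r _ _ => hf.adj r (by omega))
          fun r _ _ => hmem r (by omega) (by omega)).symm
  · intro l m hlm
    rw [Set.disjoint_left]
    rintro _ ⟨a, ha, rfl⟩ ⟨b, hb, e⟩
    obtain rfl := hf.injOn (hB m hb) (hA l ha) e
    fin_cases l <;> fin_cases m <;> simp [A, B] at ha hb hlm <;> omega

end Outerplanar

/-! ### Forests -/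

section Forests

variable {V : Type u} {G : SimpleGraph V}

theorem degenerateOn_of_isAcyclic [Finite V] (h : G.IsAcyclic) (s : Set V) :
    DegenerateOn G 1 s := by
  refine degenerateOn_of_forall (fun t ht => ?_) s
  have : Nonempty t := ht.to_subtype
  have hac : (G.induce t).IsAcyclic := h.induce t
  obtain ⟨u, v, p, hp, hmax⟩ := Walk.exists_isPath_forall_isPath_length_le_length (G.induce t)
  -- Every neighbour of the first vertex of a longest path is the second vertex of that path.
  refine ⟨u, u.2, (Set.ncard_le_ncard (t := {(p.snd : V)}) ?_ (Set.toFinite _)).trans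
    (Set.ncard_singleton _).le⟩
  rintro w ⟨hw, hadj⟩
  have hadj' : (G.induce t).Adj u ⟨w, hw⟩ := hadj.symm
  refine congrArg Subtype.val (hac.eq_snd_of_adj_start hp hadj' ?_)
  by_contra hnot
  have := hmax _ _ _ (hp.cons hnot (h := hadj'.symm))
  rw [Walk.length_cons] at this
  omega

variable [Fintype V]

/-- The last vertex of a cycle has two neighbours on the cycle, both of them earlier. -/
theorem isAcyclic_of_maxInDegree_le_one {σ : V ≃ Fin (Fintype.card V)}
    (h : maxInDegree G σ ≤ 1) : G.IsAcyclic := by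
  classical
  intro u c hc
  obtain ⟨v, hv, hmax⟩ := c.support.toFinset.exists_max_image σ ⟨u, by simp⟩
  rw [List.mem_toFinset] at hv
  have hc' : (c.rotate v hv).IsCycle := (Walk.isCycle_rotate hv).2 hc
  have hmem : ∀ w, w ∈ (c.rotate v hv).support → w ∈ c.support := fun w hw =>
    (c.mem_support_rotate_iff v hv).1 hw
  generalize c.rotate v hv = d at hc' hmem
  have hlt : ∀ w, w ∈ d.support → G.Adj w v → σ w < σ v := fun w hw hadj =>
    lt_of_le_of_ne (hmax w (List.mem_toFinset.2 (hmem w hw))) fun e => hadj.ne (σ.injective e)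
  have h1 : G.Adj d.snd v := (d.adj_snd hc'.not_nil).symm
  have h2 : G.Adj d.penultimate v := d.adj_penultimate hc'.not_nil
  have h3 : ({d.snd, d.penultimate} : Set V) ⊆ {w | G.Adj w v ∧ σ w < σ v} := by
    rintro w (rfl | rfl)
    · exact ⟨h1, hlt _ (d.getVert_mem_support _) h1⟩
    · exact ⟨h2, hlt _ (d.getVert_mem_support _) h2⟩
  have h4 := Set.ncard_le_ncard h3 (Set.toFinite _)
  rw [Set.ncard_pair hc'.snd_ne_penultimate] at h4
  have h5 := le_maxInDegree G σ v
  unfold inDegree at h5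
  omega

theorem greedyOrientable_zero_iff_isAcyclic [Nonempty V] (hG : G.IsBipartite) :
    GreedyOrientable G 0 ↔ G.IsAcyclic := by
  constructor
  · rintro ⟨σ, hσ⟩
    rw [Nat.cast_zero, add_zero] at hσ
    have h2 : ((maxInDegree G σ + 1 : ℕ) : ℕ∞) ≤ (2 : ℕ) :=
      hσ ▸ Colorable.chromaticNumber_le hG
    exact isAcyclic_of_maxInDegree_le_one (Nat.succ_le_succ_iff.1 (Nat.cast_le.1 h2))
  · intro h
    by_cases hE : ∃ a b, G.Adj a b
    · obtain ⟨a, b, hab⟩ := hE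
      exact (degenerateOn_of_isAcyclic h _).greedyOrientable_zero
        (two_le_chromaticNumber_of_adj hab)
    · push Not at hE
      have h0 : DegenerateOn G 0 Set.univ :=
        degenerateOn_of_forall (fun t ⟨v, hv⟩ => ⟨v, hv, by simp [hE]⟩) _
      refine h0.greedyOrientable_zero ?_
      have := (colorable_of_fintype G).chromaticNumber_pos
      simpa [Order.one_le_iff_pos] using this

end Forests

/-! ### Orderings with prescribed maximum in-degree -/

section ExactInDegree

variable {V : Type u} [Fintype V] {G : SimpleGraph V}

/-- Exchanging two consecutive vertices of an ordering changes every in-degree by at most one, as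
the order is preserved on all other pairs. -/
theorem maxInDegree_swap_le (G : SimpleGraph V) (σ : V ≃ Fin (Fintype.card V))
    {x y : Fin (Fintype.card V)} (hxy : (y : ℕ) = x + 1) :
    maxInDegree G (σ.trans (Equiv.swap x y)) ≤ maxInDegree G σ + 1 := by
  refine maxInDegree_le_iff.2 fun v => le_trans ?_ (Nat.succ_le_succ (le_maxInDegree G σ v))
  unfold inDegree
  refine le_trans (Set.ncard_le_ncard (t := insert (σ.symm y) {w | G.Adj w v ∧ σ w < σ v}) ?_
    (Set.toFinite _)) (Set.ncard_insert_le _ _)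
  rintro w ⟨hadj, hlt⟩
  by_cases hw : w = σ.symm y
  · exact .inl hw
  · refine .inr ⟨hadj, ?_⟩
    have hwy : σ w ≠ y := fun e => hw (by rw [← e, Equiv.symm_apply_apply])
    have hne : σ w ≠ σ v := fun e => hadj.ne (σ.injective e)
    simp only [Equiv.trans_apply, Equiv.swap_apply_def] at hlt
    split_ifs at hlt <;> simp only [Fin.lt_def, Fin.ext_iff, ne_eq] at * <;> omega

/-- Induction over orderings: any ordering is turned into any other by exchanging consecutive
vertices. -/
theorem ordering_trans_of_swap {V : Type u} {M : ℕ} {P : (V ≃ Fin M) → Prop}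
    (hstep : ∀ x y : Fin M, (y : ℕ) = x + 1 → ∀ ρ, P ρ → P (ρ.trans (Equiv.swap x y)))
    (g : Equiv.Perm (Fin M)) (ρ : V ≃ Fin M) (hρ : P ρ) : P (ρ.trans g) := by
  cases M with
  | zero =>
    rw [Subsingleton.elim g (Equiv.refl _)]
    exact hρ
  | succ N =>
    have hg : g ∈ Submonoid.closure
        (Set.range fun i : Fin N => Equiv.swap i.castSucc i.succ) := by
      rw [Equiv.Perm.mclosure_swap_castSucc_succ]; trivial
    induction hg using Submonoid.closure_induction generalizing ρ with
    | mem g hg =>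
      obtain ⟨i, rfl⟩ := hg
      exact hstep _ _ (by simp) ρ hρ
    | one => exact hρ
    | mul g h _ _ ihg ihh => exact ihg (ρ.trans h) (ihh ρ hρ)

/-- Discrete intermediate value theorem for the maximum in-degree. -/
theorem exists_maxInDegree_eq {σ τ : V ≃ Fin (Fintype.card V)} {k : ℕ}
    (hσ : maxInDegree G σ ≤ k) (hτ : k ≤ maxInDegree G τ) :
    ∃ ρ : V ≃ Fin (Fintype.card V), maxInDegree G ρ = k := by
  by_contra! hne
  have hstep : ∀ x y : Fin (Fintype.card V), (y : ℕ) = x + 1 →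
      ∀ ρ : V ≃ Fin (Fintype.card V), maxInDegree G ρ ≤ k →
        maxInDegree G (ρ.trans (Equiv.swap x y)) ≤ k := by
    intro x y hxy ρ hρ
    have h1 := maxInDegree_swap_le G ρ hxy
    have h2 := hne ρ
    have h3 := hne (ρ.trans (Equiv.swap x y))
    omega
  have h := ordering_trans_of_swap (P := fun ρ => maxInDegree G ρ ≤ k) hstep (σ.symm.trans τ) σ hσ
  rw [← Equiv.trans_assoc, Equiv.self_trans_symm, Equiv.refl_trans] at h
  exact hne τ (le_antisymm h hτ)

/-- Placing a vertex last makes its in-degree equal to its degree. -/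
theorem exists_ncard_neighborSet_le_maxInDegree (G : SimpleGraph V) (v : V) :
    ∃ σ : V ≃ Fin (Fintype.card V), (G.neighborSet v).ncard ≤ maxInDegree G σ := by
  let last : Fin (Fintype.card V) :=
    ⟨Fintype.card V - 1, Nat.sub_lt (Fintype.card_pos_iff.2 ⟨v⟩) one_pos⟩
  let σ := (Fintype.equivFin V).trans (Equiv.swap (Fintype.equivFin V v) last)
  have hσ : σ v = last := by simp [σ]
  refine ⟨σ, le_trans (Set.ncard_le_ncard ?_ (Set.toFinite _)) (le_maxInDegree G σ v)⟩
  intro w hw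
  have hw' : G.Adj v w := hw
  refine ⟨hw'.symm, lt_of_le_of_ne ?_ fun e => hw'.ne' (σ.injective e)⟩
  rw [hσ, Fin.le_def]
  exact Nat.le_sub_one_of_lt (σ w).2

theorem DegenerateOn.greedyOrientable_one_of_isBipartite (h : DegenerateOn G 2 Set.univ)
    (hG : G.IsBipartite) {v a b : V} (hab : a ≠ b) (ha : G.Adj v a) (hb : G.Adj v b) :
    GreedyOrientable G 1 := by
  obtain ⟨σ, hσ⟩ := h.exists_maxInDegree_le
  obtain ⟨τ, hτ⟩ := exists_ncard_neighborSet_le_maxInDegree G v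
  have h2 : 2 ≤ (G.neighborSet v).ncard := by
    rw [← Set.ncard_pair hab]
    exact Set.ncard_le_ncard (by rintro w (rfl | rfl) <;> assumption) (Set.toFinite _)
  obtain ⟨ρ, hρ⟩ := exists_maxInDegree_eq hσ (h2.trans hτ)
  have hχ : G.chromaticNumber = 2 :=
    le_antisymm (Colorable.chromaticNumber_le hG) (two_le_chromaticNumber_of_adj ha)
  exact ⟨ρ, by rw [hρ, hχ]; norm_num⟩

end ExactInDegree

end RobustColoring

theorem mainTheorem10 {V : Type*} [Fintype V] (G : SimpleGraph V) :
    -- (i) trees are exactly the (connected) bipartite graphs that are 0-greedy orientable;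
    -- without connectedness, the 0-greedy orientable bipartite graphs are the forests
    ((G.IsTree ↔ G.Connected ∧ G.IsBipartite ∧ RobustColoring.GreedyOrientable G 0) ∧
      (Nonempty V → G.IsBipartite →
        (RobustColoring.GreedyOrientable G 0 ↔ G.IsAcyclic))) ∧
    -- (ii)
    (RobustColoring.IsSeriesParallel G → G.chromaticNumber = 3 →
      RobustColoring.GreedyOrientable G 0) ∧
    -- (iii) some vertex has two distinct neighbours
    (RobustColoring.IsOuterplanar G → G.IsBipartite →
      (∃ v a b : V, a ≠ b ∧ G.Adj v a ∧ G.Adj v b) →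
      RobustColoring.GreedyOrientable G 1) ∧
    -- (iv)
    (∀ l : ℕ, RobustColoring.IsKTree G l → G.chromaticNumber = ((l + 1 : ℕ) : ℕ∞) →
      RobustColoring.GreedyOrientable G 0) := by
  refine ⟨⟨?_, ?_⟩, ?_, ?_, ?_⟩
  · constructor
    · intro h
      have := h.connected.nonempty
      exact ⟨h.connected, h.isBipartite,
        (RobustColoring.greedyOrientable_zero_iff_isAcyclic h.isBipartite).2 h.isAcyclic⟩
    · rintro ⟨hconn, hbip, hgo⟩
      have := hconn.nonempty
      exact ⟨hconn, (RobustColoring.greedyOrientable_zero_iff_isAcyclic hbip).1 hgo⟩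
  · intro _ hbip
    exact RobustColoring.greedyOrientable_zero_iff_isAcyclic hbip
  · intro h hχ
    exact h.degenerateOn.greedyOrientable_zero (le_of_eq (by rw [hχ]; rfl))
  · rintro h hbip ⟨v, a, b, hab, ha, hb⟩
    refine (h.degenerateOn (fun x y z hxy hyz hxz => ?_) _).greedyOrientable_one_of_isBipartite
      hbip hab ha hb
    obtain ⟨c⟩ := hbip
    have h1 := c.valid hxy
    have h2 := c.valid hyz
    have h3 := c.valid hxz
    omega
  · intro l h hχ
    exact (RobustColoring.IsKTreeOn.degenerateOn h).greedyOrientable_zero hχ.ge
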